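/- \textbf{Setting.} Let $P$ be a probability distribution on a measurable space $\mathcal X$ and let $X_1,X_2,\dots$ be i.i.d. with law $P$. Let $H_1,\dots,H_s$ be hypotheses, $H_i$ being a set of probability distributions on $\mathcal X$, and let $I(P)=\{i : P\in H_i\}$ be the set of indices of true hypotheses. For every $n$ and $i$ let $T_{n,i}=T_{n,i}(X_1,\dots,X_n)$ be a real-valued (measurable) test statistic. Fix an integer $k\ge 1$ and $\alpha\in(0,1)$. For $|K|\ge k$, $k\text{-}\max(y_i:i\in K)$ denotes the $k$-th largest of the numbers $y_i$, $i\in K$. Let $G_{n,K}(P)$ be the joint distribution of $(T_{n,i}:i\in K)$. \textbf{Assumption S.} $G_{n,I(P)}(P)$ converges weakly to a probability distribution $G_{I(P)}$ on $\mathbb R^{|I(P)|}$. Moreover, if $|I(P)|\ge k$, let $H_{I(P)}(x,k)$ be the c.d.f. of $k\text{-}\max(T_i:i\in I(P))$ when $(T_i)_{i\in I(P)}\sim G_{I(P)}$, and let $c_{I(P)}(1-\alpha,k)=\inf\{x: H_{I(P)}(x,k)\ge 1-\alpha\}$; then $H_{I(P)}(\cdot,k)$ is continuous and strictly increasing at $c=c_{I(P)}(1-\alpha,k)$,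 the latter meaning $H_{I(P)}(x,k)<H_{I(P)}(c,k)<H_{I(P)}(y,k)$ for all $x<c<y$. \textbf{Subsampling.} Let $b=b_n$ be positive integers. For each of the $N_n=\binom nb$ subsets $a$ of $\{1,\dots,n\}$ of size $b$ let $T_{b,i}^{(a)}$ be the statistic $T_{b,i}$ evaluated at $(X_j: j\in a)$, taken in increasing order of $j$. Let $\hat G_{n,K}$ be the empirical distribution of the $N_n$ vectors $(T_{b,i}^{(a)}:i\in K)$, and $$\hat H_{n,K}(x,k)=\frac1{N_n}\sum_a \mathbf 1\{k\text{-}\max(T^{(a)}_{b,i}:i\in K)\le x\},\qquad \hat c_{n,K}(1-\alpha,k)=\inf\{x:\hat H_{n,K}(x,k)\ge 1-\alpha\}.$$ \textbf{Step-down method.} First reject every $H_i$ with $T_{n,i}>\hat c_{n,\{1,\dots,s\}}(1-\alpha,k)$. Then repeat: let $R$ be the set of indices rejected so far and $A$ its complement. If $|R|<k$, stop. Otherwise reject every $H_i$, $i\in A$, with $T_{n,i}>\max\{\hat c_{n,A\cup I}(1-\alpha,k): I\subset R,\ |I|=k-1\}$; if there are no further rejections, stop. Let $k\text{-FWER}_P$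 be the probability that at least $k$ of the hypotheses $H_i$, $i\in I(P)$, are rejected. \textbf{Theorem.} Suppose Assumption S holds, $b\to\infty$ and $b/n\to0$ as $n\to\infty$. Then: (i) for every metric $\rho$ metrizing weak convergence of probability distributions on $\mathbb R^{|I(P)|}$, $\rho(\hat G_{n,I(P)},G_{n,I(P)}(P))\to0$ in probability; (ii) if $|I(P)|\ge k$, then $\hat c_{n,I(P)}(1-\alpha,k)\to c_{I(P)}(1-\alpha,k)$ in probability; (iii) $\limsup_n k\text{-FWER}_P\le\alpha$ for the step-down method above. -/

import Mathlib

open MeasureTheory ProbabilityTheory Filter Topology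
open scoped ENNReal

noncomputable section

namespace SubsamplingKFWER

/-- `k-max (y i : i ∈ K)`: the `k`-th largest of the values `y i`, `i ∈ K`, counted with
multiplicity. It is meant for `1 ≤ k ≤ |K|`. -/
def kMax {ι : Type*} (k : ℕ) (K : Finset ι) (y : ι → ℝ) : ℝ :=
  ((K.val.map y).sort (· ≥ ·)).getD (k - 1) 0

section StepDown

variable {ι : Type*} [Fintype ι] [DecidableEq ι]

/-- The critical value of a later step of the step-down method, when `R` is the set of indices of
the hypotheses rejected so far: the maximum of `c (Rᶜ ∪ I)` over `I ⊆ R` with `|I| = k - 1`. -/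
def stepCritical (k : ℕ) (c : Finset ι → ℝ) (R : Finset ι) (h : k ≤ R.card) : ℝ :=
  (R.powersetCard (k - 1)).sup'
    (Finset.powersetCard_nonempty.2 ((Nat.sub_le k 1).trans h)) (fun I => c (Rᶜ ∪ I))

/-- The first step: reject every hypothesis whose statistic exceeds `c {1, …, s}`. -/
def firstStep (c : Finset ι → ℝ) (t : ι → ℝ) : Finset ι :=
  Finset.univ.filter (fun i => c Finset.univ < t i)

/-- A later step, acting on the set `R` of indices rejected so far. If fewer than `k` hypotheses
have been rejected nothing more is rejected. A set that is left unchanged is where the method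
stops. -/
def laterStep (k : ℕ) (c : Finset ι → ℝ) (t : ι → ℝ) (R : Finset ι) : Finset ι :=
  if h : k ≤ R.card then
    R ∪ Rᶜ.filter (fun i => stepCritical k c R h < t i)
  else R

/-- The set of indices rejected by the generic step-down method with test statistics `t` and
critical values `c K`. Each step before the method stops rejects at least one more hypothesis, so
that the method has stopped after as many later steps as there are hypotheses. -/
def stepDown (k : ℕ) (c : Finset ι → ℝ) (t : ι → ℝ) : Finset ι :=
  (laterStep k c t)^[Fintype.card ι] (firstStep c t)

end StepDown

section Laws

variable {𝒳 : Type*} [MeasurableSpace 𝒳] {s : ℕ}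

/-- `I(P)`: the indices of the true hypotheses, `H i` being the set of the probability
distributions that satisfy the `i`-th hypothesis. -/
def trueNulls (H : Fin s → Set (ProbabilityMeasure 𝒳)) (P : ProbabilityMeasure 𝒳) :
    Finset (Fin s) :=
  open Classical in Finset.univ.filter (fun i => P ∈ H i)

/-- `G_{n,K}(P)`: the joint distribution of the statistics `T n i`, `i ∈ K`, evaluated at
`n` independent observations from `P`. -/
def jointLaw (T : (n : ℕ) → Fin s → (Fin n → 𝒳) → ℝ) (hT : ∀ n i, Measurable (T n i))
    (P : ProbabilityMeasure 𝒳) (n : ℕ) (K : Finset (Fin s)) : ProbabilityMeasure (K → ℝ) :=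
  ⟨(Measure.pi (fun _ : Fin n => (P : Measure 𝒳))).map (fun x (i : K) => T n i x),
    Measure.isProbabilityMeasure_map
      (measurable_pi_lambda _ (fun i : K => hT n i)).aemeasurable⟩

/-- The c.d.f. at `x` of the `k`-max of a random vector with joint distribution `G`. -/
def kMaxCdf {K : Finset (Fin s)} (G : ProbabilityMeasure (K → ℝ)) (k : ℕ) (x : ℝ) : ℝ :=
  (G : Measure (K → ℝ)).real {y | kMax k Finset.univ y ≤ x}

/-- The `p`-quantile of the `k`-max of a random vector with joint distribution `G`. -/
def kMaxQuantile {K : Finset (Fin s)} (G : ProbabilityMeasure (K → ℝ)) (k : ℕ) (p : ℝ) : ℝ :=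
  sInf {x : ℝ | p ≤ kMaxCdf G k x}

/-- The statistics `T n i`, `i ∈ K`, have the joint limit law `G`, and the c.d.f. of the `k`-max
under `G` is continuous and strictly increasing at its `1 - α` quantile. The `k`-max of the limit
makes sense when `k ≤ |K|`; otherwise nothing is assumed about it. -/
structure AssumptionS (T : (n : ℕ) → Fin s → (Fin n → 𝒳) → ℝ) (hT : ∀ n i, Measurable (T n i))
    (P : ProbabilityMeasure 𝒳) (K : Finset (Fin s)) (k : ℕ) (α : ℝ)
    (G : ProbabilityMeasure (K → ℝ)) : Prop where
  tendsto_jointLaw : Tendsto (fun n => jointLaw T hT P n K) atTop (𝓝 G)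
  continuousAt_cdf : k ≤ K.card → ContinuousAt (kMaxCdf G k) (kMaxQuantile G k (1 - α))
  cdf_lt_left : k ≤ K.card → ∀ x < kMaxQuantile G k (1 - α),
    kMaxCdf G k x < kMaxCdf G k (kMaxQuantile G k (1 - α))
  cdf_lt_right : k ≤ K.card → ∀ x > kMaxQuantile G k (1 - α),
    kMaxCdf G k (kMaxQuantile G k (1 - α)) < kMaxCdf G k x

end Laws

section Subsampling

variable {𝒳 : Type*} {s : ℕ}

/-- The statistic `T b i` evaluated at the subsample of `x` with index set `a`, where `|a| = b`;
the observations are kept in their original order. -/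
def subStat (T : (n : ℕ) → Fin s → (Fin n → 𝒳) → ℝ) (b : ℕ) {n : ℕ} (x : Fin n → 𝒳)
    (a : {a : Finset (Fin n) // a.card = b}) (i : Fin s) : ℝ :=
  T b i (fun j => x (a.1.orderEmbOfFin a.2 j))

/-- The empirical distribution of the `n.choose b` vectors of subsample statistics with indices
in `K`. -/
def subMeasure (T : (n : ℕ) → Fin s → (Fin n → 𝒳) → ℝ) (b : ℕ) {n : ℕ} (x : Fin n → 𝒳)
    (K : Finset (Fin s)) : Measure (K → ℝ) :=
  (n.choose b : ℝ≥0∞)⁻¹ • ∑ a : {a : Finset (Fin n) // a.card = b},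
    Measure.dirac (fun i : K => subStat T b x a i)

theorem isProbabilityMeasure_subMeasure (T : (n : ℕ) → Fin s → (Fin n → 𝒳) → ℝ) {b n : ℕ}
    (h : b ≤ n) (x : Fin n → 𝒳) (K : Finset (Fin s)) :
    IsProbabilityMeasure (subMeasure T b x K) := by
  constructor
  have h0 : (n.choose b : ℝ≥0∞) ≠ 0 := by
    exact_mod_cast (Nat.choose_pos h).ne'
  simp [subMeasure, Measure.finsetSum_apply, Fintype.card_finset_len,
    ENNReal.inv_mul_cancel h0 (ENNReal.natCast_ne_top _)]

/-- The subsampling estimate of the joint distribution. There are no subsamples when `n < b`, and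
the value is then irrelevant. -/
def subLaw (T : (n : ℕ) → Fin s → (Fin n → 𝒳) → ℝ) (b : ℕ) {n : ℕ} (x : Fin n → 𝒳)
    (K : Finset (Fin s)) : ProbabilityMeasure (K → ℝ) :=
  if h : b ≤ n then ⟨subMeasure T b x K, isProbabilityMeasure_subMeasure T h x K⟩
  else ⟨Measure.dirac 0, inferInstance⟩

/-- The subsampling estimate of the c.d.f. of the `k`-max of the statistics with indices in `K`. -/
def subCdf (T : (n : ℕ) → Fin s → (Fin n → 𝒳) → ℝ) (b : ℕ) {n : ℕ} (x : Fin n → 𝒳)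
    (K : Finset (Fin s)) (k : ℕ) (u : ℝ) : ℝ :=
  (n.choose b : ℝ)⁻¹ * ∑ a : {a : Finset (Fin n) // a.card = b},
    if kMax k K (subStat T b x a) ≤ u then 1 else 0

/-- The subsampling critical value: the `p`-quantile of the estimated distribution of the
`k`-max. -/
def subQuantile (T : (n : ℕ) → Fin s → (Fin n → 𝒳) → ℝ) (b : ℕ) {n : ℕ} (x : Fin n → 𝒳)
    (k : ℕ) (p : ℝ) (K : Finset (Fin s)) : ℝ :=
  sInf {u : ℝ | p ≤ subCdf T b x K k u}

end Subsampling

/-- The first `n` observations. -/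
def sample {Ω 𝒳 : Type*} (X : ℕ → Ω → 𝒳) (n : ℕ) (ω : Ω) : Fin n → 𝒳 := fun j => X j ω

/-- The metric `ρ` on the probability distributions on `E` metrizes weak convergence. -/
def MetrizesWeakConvergence {E : Type*} [TopologicalSpace E] [MeasurableSpace E]
    [OpensMeasurableSpace E] (ρ : MetricSpace (ProbabilityMeasure E)) : Prop :=
  ρ.toPseudoMetricSpace.toUniformSpace.toTopologicalSpace =
    (inferInstance : TopologicalSpace (ProbabilityMeasure E))

end SubsamplingKFWER

end

/-!
For a bounded function `f` of the statistics, the integral of `f` against the subsampling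
distribution is a U-statistic whose kernel `φ` need not be symmetric. It is the average over all
permutations of the indices of the averages of `φ` over `⌊n / b⌋` disjoint blocks, so its variance
is at most `Var φ / ⌊n / b⌋`, which tends to `0`, while its mean is the integral of `f` against the
distribution of the statistics at sample size `b`. By Chebyshev's inequality the subsampling
distribution converges weakly to the limit law in probability, and by the portmanteau theorem its
quantiles converge at every level where the limiting quantile is unique.

In the step-down method, the critical value of every step that is reached with fewer than `k` false
rejections is at least the one computed from the true hypotheses alone, because the critical values
increase with the index set and one of the competing index sets contains all true hypotheses. Hence
at least `k` false rejections occur only if the `k`-max over the true hypotheses exceeds its own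
subsampling quantile.
-/

open scoped BigOperators

namespace SubsamplingKFWER

section KMax

theorem getElem_iff_lt_countP_of_pairwise_ge {α : Type*} [Preorder α] {l : List α}
    (hl : l.Pairwise (· ≥ ·)) {p : α → Prop} [DecidablePred p] (hp : Monotone p) {j : ℕ}
    (hj : j < l.length) : p l[j] ↔ j < l.countP (fun x => decide (p x)) := by
  induction l generalizing j with
  | nil => simp at hj
  | cons a l ih =>
    rw [List.pairwise_cons] at hl
    by_cases ha : p a
    · cases j with
      | zero => simp [ha]
      | succ j =>
        rw [List.getElem_cons_succ, ih hl.2 (by simpa using hj)]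
        simp [ha]
    · have hnot : ∀ x ∈ a :: l, ¬ p x :=
        List.forall_mem_cons.2 ⟨ha, fun x hx h => ha (hp (hl.1 x hx) h)⟩
      have hcount : (a :: l).countP (fun x => decide (p x)) = 0 := by
        simpa [List.countP_eq_zero] using hnot
      simpa [hcount] using hnot _ (List.getElem_mem hj)

variable {ι : Type*} {k : ℕ} {K K' : Finset ι}

theorem pred_kMax_iff (hk : 1 ≤ k) (hK : k ≤ K.card) (y : ι → ℝ)
    {p : ℝ → Prop} [DecidablePred p] (hp : Monotone p) :
    p (kMax k K y) ↔ k ≤ (K.filter (fun i => p (y i))).card := by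
  have hlen : k - 1 < ((K.val.map y).sort (· ≥ ·)).length := by
    rw [Multiset.length_sort, Multiset.card_map, Finset.card_val]
    lia
  have hcount : ((K.val.map y).sort (· ≥ ·)).countP (fun x => decide (p x)) =
      (K.filter (fun i => p (y i))).card := by
    rw [← Multiset.coe_countP, Multiset.sort_eq, Multiset.countP_map]
    rfl
  rw [kMax, List.getD_eq_getElem _ _ hlen,
    getElem_iff_lt_countP_of_pairwise_ge (Multiset.pairwise_sort _ _) hp, hcount]
  lia

theorem lt_kMax_iff (hk : 1 ≤ k) (hK : k ≤ K.card) (y : ι → ℝ) (u : ℝ) :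
    u < kMax k K y ↔ k ≤ (K.filter (fun i => u < y i)).card :=
  pred_kMax_iff hk hK y fun _ _ h h' => lt_of_lt_of_le h' h

theorem le_kMax_iff (hk : 1 ≤ k) (hK : k ≤ K.card) (y : ι → ℝ) (u : ℝ) :
    u ≤ kMax k K y ↔ k ≤ (K.filter (fun i => u ≤ y i)).card :=
  pred_kMax_iff hk hK y fun _ _ h h' => le_trans h' h

theorem kMax_mono_set (hk : 1 ≤ k) (hK : k ≤ K.card) (h : K ⊆ K') (y : ι → ℝ) :
    kMax k K y ≤ kMax k K' y := by
  rw [le_kMax_iff hk (hK.trans (Finset.card_le_card h))]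
  exact ((le_kMax_iff hk hK y _).1 le_rfl).trans
    (Finset.card_le_card (Finset.filter_subset_filter _ h))

theorem kMax_univ_coe (K : Finset ι) (y : ι → ℝ) :
    kMax k (Finset.univ : Finset K) (fun i : K => y i) = kMax k K y := by
  have hmap : (Finset.univ : Finset K).val.map (fun i : K => y i) = K.val.map y := by
    rw [Finset.univ_eq_attach, Finset.attach_val]
    exact Multiset.attach_map_val' K.val y
  rw [kMax, kMax, hmap]

theorem kMax_eq_zero_of_card_lt (hK : K.card < k) (y : ι → ℝ) : kMax k K y = 0 :=
  List.getD_eq_default _ _ (by simpa using Nat.le_sub_one_of_lt hK)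

theorem lipschitzWith_kMax [Fintype ι] (k : ℕ) (K : Finset ι) :
    LipschitzWith 1 (fun y : ι → ℝ => kMax k K y) := by
  wlog hk : 1 ≤ k generalizing k
  · obtain rfl : k = 0 := by lia
    -- `k - 1` truncates, so that `kMax 0` is `kMax 1`.
    exact this 1 le_rfl
  rcases lt_or_ge K.card k with hK | hK
  · simpa only [kMax_eq_zero_of_card_lt hK] using (LipschitzWith.const (0 : ℝ)).weaken zero_le_one
  refine LipschitzWith.of_le_add fun y y' => sub_le_iff_le_add.1 ?_
  rw [le_kMax_iff hk hK]
  refine ((le_kMax_iff hk hK y _).1 le_rfl).trans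
    (Finset.card_le_card (Finset.monotone_filter_right _ fun i _ hi => ?_))
  have hdist : |y i - y' i| ≤ dist y y' := dist_le_pi_dist y y' i
  linarith [le_abs_self (y i - y' i)]

end KMax

section StepDown

variable {ι : Type*} [Fintype ι] [DecidableEq ι] {k : ℕ} {c : Finset ι → ℝ} {I R : Finset ι}

theorem le_stepCritical (hc : ∀ K, I ⊆ K → c I ≤ c K) (h : k ≤ R.card)
    (hR : (R ∩ I).card < k) : c I ≤ stepCritical k c R h := by
  obtain ⟨J, hJ, hJR, hcard⟩ := Finset.exists_subsuperset_card_eq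
    (Finset.inter_subset_left : R ∩ I ⊆ R) (Nat.le_sub_one_of_lt hR) ((Nat.sub_le k 1).trans h)
  have hI : I ⊆ Rᶜ ∪ J := fun i hi => by
    by_cases hiR : i ∈ R
    · exact Finset.mem_union_right _ (hJ (Finset.mem_inter.2 ⟨hiR, hi⟩))
    · exact Finset.mem_union_left _ (Finset.mem_compl.2 hiR)
  exact (hc _ hI).trans
    (Finset.le_sup' (fun J => c (Rᶜ ∪ J)) (Finset.mem_powersetCard.2 ⟨hJR, hcard⟩))

theorem firstStep_inter_subset (hc : ∀ K, I ⊆ K → c I ≤ c K) (t : ι → ℝ) :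
    firstStep c t ∩ I ⊆ I.filter (fun i => c I < t i) := by
  intro i hi
  simp only [firstStep, Finset.mem_inter, Finset.mem_filter, Finset.mem_univ, true_and] at hi ⊢
  exact ⟨hi.2, (hc _ (Finset.subset_univ _)).trans_lt hi.1⟩

theorem laterStep_inter_subset (hc : ∀ K, I ⊆ K → c I ≤ c K) {t : ι → ℝ}
    (hlt : (I.filter (fun i => c I < t i)).card < k)
    (hR : R ∩ I ⊆ I.filter (fun i => c I < t i)) :
    laterStep k c t R ∩ I ⊆ I.filter (fun i => c I < t i) := by
  rw [laterStep]
  split_ifs with h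
  · rw [Finset.union_inter_distrib_right]
    refine Finset.union_subset hR fun i hi => ?_
    simp only [Finset.mem_inter, Finset.mem_filter] at hi ⊢
    exact ⟨hi.2, (le_stepCritical hc h ((Finset.card_le_card hR).trans_lt hlt)).trans_lt hi.1.2⟩
  · exact hR

theorem lt_kMax_of_le_card_stepDown_inter (hk : 1 ≤ k) (hc : ∀ K, I ⊆ K → c I ≤ c K)
    {t : ι → ℝ} (h : k ≤ (stepDown k c t ∩ I).card) : c I < kMax k I t := by
  rw [lt_kMax_iff hk (h.trans (Finset.card_le_card Finset.inter_subset_right))]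
  by_contra! hlt
  refine hlt.not_ge (h.trans (Finset.card_le_card ?_))
  exact Function.Iterate.rec (fun R => R ∩ I ⊆ I.filter (fun i => c I < t i))
    (firstStep_inter_subset hc t) (fun _ => laterStep_inter_subset hc hlt) _

end StepDown

section Average

theorem expect_smul {G X : Type*} [Group G] [Fintype G] [Fintype X] [MulAction G X]
    [MulAction.IsPretransitive G X] (f : X → ℝ) (x : X) :
    𝔼 g : G, f (g • x) = 𝔼 y, f y := by
  have hconst : ∀ y, 𝔼 g : G, f (g • y) = 𝔼 g : G, f (g • x) := fun y => by
    obtain ⟨h, rfl⟩ := MulAction.exists_smul_eq G x y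
    exact Fintype.expect_equiv (Equiv.mulRight h) _ _ fun g => by simp [mul_smul]
  have : Nonempty X := ⟨x⟩
  calc 𝔼 g : G, f (g • x) = 𝔼 y, 𝔼 g : G, f (g • y) := by simp only [hconst, Fintype.expect_const]
    _ = 𝔼 g : G, 𝔼 y, f (g • y) := Finset.expect_comm ..
    _ = 𝔼 g : G, 𝔼 y, f y := by
      congr! 1 with g
      exact Fintype.expect_equiv (MulAction.toPerm g) _ _ fun _ => rfl
    _ = 𝔼 y, f y := Fintype.expect_const _

variable {Ω ι : Type*} [MeasurableSpace Ω] {μ : Measure Ω} [Fintype ι] {Z : ι → Ω → ℝ}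

theorem integral_expect (hZ : ∀ i, Integrable (Z i) μ) :
    ∫ ω, 𝔼 i, Z i ω ∂μ = 𝔼 i, ∫ ω, Z i ω ∂μ := by
  simp only [Fintype.expect_eq_sum_div_card, integral_div, integral_finsetSum _ fun i _ => hZ i]

theorem memLp_expect {p : ℝ≥0∞} (hZ : ∀ i, MemLp (Z i) p μ) :
    MemLp (fun ω => 𝔼 i, Z i ω) p μ := by
  simp only [Fintype.expect_eq_sum_div_card, div_eq_inv_mul]
  exact (memLp_finsetSum _ fun i _ => hZ i).const_mul _

theorem sq_expect_le (f : ι → ℝ) : (𝔼 i, f i) ^ 2 ≤ 𝔼 i, f i ^ 2 := by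
  simpa only [Fintype.expect_eq_sum_div_card, Finset.card_univ] using
    sum_div_card_sq_le_sum_sq_div_card (s := Finset.univ) (f := f)

theorem variance_expect_le [IsFiniteMeasure μ] (hZ : ∀ i, MemLp (Z i) 2 μ) :
    Var[fun ω => 𝔼 i, Z i ω; μ] ≤ 𝔼 i, Var[Z i; μ] := by
  have hint : ∀ i, Integrable (fun ω => (Z i ω - ∫ ω', Z i ω' ∂μ) ^ 2) μ := fun i =>
    ((hZ i).sub (memLp_const _)).integrable_sq
  calc Var[fun ω => 𝔼 i, Z i ω; μ]
      = ∫ ω, (𝔼 i, (Z i ω - ∫ ω', Z i ω' ∂μ)) ^ 2 ∂μ := by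
        rw [variance_eq_integral (memLp_expect hZ).aemeasurable,
          integral_expect fun i => (hZ i).integrable one_le_two]
        simp only [Finset.expect_sub_distrib]
    _ ≤ ∫ ω, 𝔼 i, (Z i ω - ∫ ω', Z i ω' ∂μ) ^ 2 ∂μ :=
        integral_mono_of_nonneg (ae_of_all _ fun ω => sq_nonneg _)
          (memLp_one_iff_integrable.1 (memLp_expect fun i => memLp_one_iff_integrable.2 (hint i)))
          (ae_of_all _ fun ω => sq_expect_le _)
    _ = 𝔼 i, Var[Z i; μ] := by
        simp only [integral_expect hint, variance_eq_integral (hZ _).aemeasurable]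

theorem variance_expect_of_pairwise_indepFun (hZ : ∀ i, MemLp (Z i) 2 μ)
    (hindep : Pairwise fun i j => IndepFun (Z i) (Z j) μ) {v : ℝ} (hv : ∀ i, Var[Z i; μ] = v) :
    Var[fun ω => 𝔼 i, Z i ω; μ] = v / Fintype.card ι := by
  have hsum : Var[∑ i, Z i; μ] = Fintype.card ι * v := by
    rw [IndepFun.variance_sum (fun i _ => hZ i) (hindep.set_pairwise _)]
    simp [hv]
  have hexpect : (fun ω => 𝔼 i, Z i ω) = (Fintype.card ι : ℝ)⁻¹ • ∑ i, Z i := by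
    ext ω
    simp [Fintype.expect_eq_sum_div_card, div_eq_inv_mul]
  rw [hexpect, variance_smul, hsum]
  rcases eq_or_ne (Fintype.card ι : ℝ) 0 with h | h
  · simp [h]
  · field_simp

end Average

section UStatistic

variable {𝒳 : Type*} {n b : ℕ}

theorem exists_pairwise_disjoint_of_mul_le {m : ℕ} (h : m * b ≤ n) :
    ∃ B : Fin m → Set.powersetCard (Fin n) b, Pairwise fun i j => Disjoint (B i).1 (B j).1 := by
  let f : Fin m × Fin b ↪ Fin n := finProdFinEquiv.toEmbedding.trans (Fin.castLEEmb h)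
  refine ⟨fun i => Set.powersetCard.ofFinEmb b (Fin n) ((Function.Embedding.sectR i _).trans f),
    fun i i' hii' => ?_⟩
  simp only [Set.powersetCard.val_ofFinEmb, Finset.disjoint_left, Finset.mem_map, Finset.mem_univ,
    true_and]
  rintro _ ⟨j, rfl⟩ ⟨j', hj'⟩
  exact hii' (congrArg Prod.fst (f.injective hj')).symm

/-- The observations with index in `a`, in their original order. -/
def subsample (x : Fin n → 𝒳) (a : Set.powersetCard (Fin n) b) : Fin b → 𝒳 :=
  fun j => x (a.1.orderEmbOfFin a.2 j)

/-- The U-statistic of order `b` with a kernel that need not be symmetric, which is evaluated at the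
observations in their original order. -/
noncomputable def uStatistic (φ : (Fin b → 𝒳) → ℝ) (x : Fin n → 𝒳) : ℝ :=
  𝔼 a : Set.powersetCard (Fin n) b, φ (subsample x a)

theorem uStatistic_eq_expect_perm {m : ℕ} [NeZero m] (φ : (Fin b → 𝒳) → ℝ) (x : Fin n → 𝒳)
    (B : Fin m → Set.powersetCard (Fin n) b) :
    uStatistic φ x = 𝔼 σ : Equiv.Perm (Fin n), 𝔼 i, φ (subsample x (σ • B i)) := by
  have : MulAction.IsPretransitive (Equiv.Perm (Fin n)) (Set.powersetCard (Fin n) b) :=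
    Set.powersetCard.isPretransitive
  rw [Finset.expect_comm]
  simp only [expect_smul fun a => φ (subsample x a), Fintype.expect_const, uStatistic]

variable [MeasurableSpace 𝒳] (P : Measure 𝒳) [IsProbabilityMeasure P]

theorem measurePreserving_subsample (a : Set.powersetCard (Fin n) b) :
    MeasurePreserving (fun x : Fin n → 𝒳 => subsample x a) (Measure.pi fun _ => P)
      (Measure.pi fun _ => P) := by
  have hindep : iIndepFun (fun (i : Fin n) (x : Fin n → 𝒳) => x i) (Measure.pi fun _ => P) :=
    iIndepFun_pi fun _ => aemeasurable_id
  refine HasLaw.measurePreserving ((hindep.precomp (a.1.orderEmbOfFin a.2).injective).hasLaw_pi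
    fun j => (measurePreserving_eval (fun _ => P) _).hasLaw) ?_
  exact measurable_pi_lambda _ fun j => measurable_pi_apply _

theorem indepFun_subsample {a a' : Set.powersetCard (Fin n) b} (h : Disjoint a.1 a'.1) :
    IndepFun (fun x : Fin n → 𝒳 => subsample x a) (fun x => subsample x a')
      (Measure.pi fun _ => P) := by
  have hindep : iIndepFun (fun (i : Fin n) (x : Fin n → 𝒳) => x i) (Measure.pi fun _ => P) :=
    iIndepFun_pi fun _ => aemeasurable_id
  have hreindex (a : Set.powersetCard (Fin n) b) : Measurable fun (x : a.1 → 𝒳) (j : Fin b) =>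
      x ⟨a.1.orderEmbOfFin a.2 j, a.1.orderEmbOfFin_mem a.2 j⟩ :=
    measurable_pi_lambda _ fun j => measurable_pi_apply _
  exact (hindep.indepFun_finset a.1 a'.1 h fun i => measurable_pi_apply i).comp
    (hreindex a) (hreindex a')

variable {P} {φ : (Fin b → 𝒳) → ℝ}

theorem memLp_uStatistic {p : ℝ≥0∞} (hφ : MemLp φ p (Measure.pi fun _ => P)) :
    MemLp (uStatistic φ) p (Measure.pi fun _ : Fin n => P) :=
  memLp_expect fun a => hφ.comp_measurePreserving (measurePreserving_subsample P a)

theorem integral_uStatistic (h : b ≤ n) (hφ : Integrable φ (Measure.pi fun _ => P)) :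
    ∫ x, uStatistic φ x ∂(Measure.pi fun _ : Fin n => P) =
      ∫ x, φ x ∂(Measure.pi fun _ => P) := by
  have hmean (a : Set.powersetCard (Fin n) b) :
      ∫ x : Fin n → 𝒳, φ (subsample x a) ∂(Measure.pi fun _ => P) =
        ∫ x, φ x ∂(Measure.pi fun _ => P) :=
    (measurePreserving_subsample P a).hasLaw.integral_comp hφ.aestronglyMeasurable
  have : Nonempty (Set.powersetCard (Fin n) b) :=
    ⟨Set.powersetCard.ofFinEmb b (Fin n) (Fin.castLEEmb h)⟩
  calc ∫ x, uStatistic φ x ∂(Measure.pi fun _ : Fin n => P)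
      = 𝔼 a : Set.powersetCard (Fin n) b,
          ∫ x : Fin n → 𝒳, φ (subsample x a) ∂(Measure.pi fun _ => P) :=
        integral_expect fun a =>
          (measurePreserving_subsample P a).integrable_comp_of_integrable hφ
    _ = ∫ x, φ x ∂(Measure.pi fun _ => P) := by simp only [hmean, Fintype.expect_const]

theorem variance_expect_subsample_of_pairwise_disjoint {ι : Type*} [Fintype ι]
    {B : ι → Set.powersetCard (Fin n) b} (hB : Pairwise fun i j => Disjoint (B i).1 (B j).1)
    (hφ : MemLp φ 2 (Measure.pi fun _ => P)) :
    Var[fun x : Fin n → 𝒳 => 𝔼 i, φ (subsample x (B i)); Measure.pi fun _ => P] =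
      Var[φ; Measure.pi fun _ => P] / Fintype.card ι := by
  have hsub (i : ι) := measurePreserving_subsample P (B i)
  have hmeas (i : ι) : AEMeasurable φ
      ((Measure.pi fun _ => P).map fun x : Fin n → 𝒳 => subsample x (B i)) :=
    (hsub i).map_eq.symm ▸ hφ.aemeasurable
  exact variance_expect_of_pairwise_indepFun (fun i => hφ.comp_measurePreserving (hsub i))
    (fun i j hij => (indepFun_subsample P (hB hij)).comp₀ (hsub i).aemeasurable
      (hsub j).aemeasurable (hmeas i) (hmeas j))
    fun i => (hsub i).variance_fun_comp hφ.aemeasurable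

theorem variance_uStatistic_le (hb : 0 < b) (h : b ≤ n) (hφ : MemLp φ 2 (Measure.pi fun _ => P)) :
    Var[uStatistic φ; Measure.pi fun _ : Fin n => P] ≤
      Var[φ; Measure.pi fun _ => P] / (n / b : ℕ) := by
  have : NeZero (n / b) := ⟨(Nat.div_pos h hb).ne'⟩
  obtain ⟨B, hB⟩ := exists_pairwise_disjoint_of_mul_le (Nat.div_mul_le_self n b)
  have hdisj (σ : Equiv.Perm (Fin n)) :
      Pairwise fun i j => Disjoint (σ • B i).1 (σ • B j).1 := fun i j hij => by
    simpa only [Set.powersetCard.coe_smul, Finset.smul_finset_def] using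
      (Finset.disjoint_image (MulAction.injective σ)).2 (hB hij)
  calc Var[uStatistic φ; Measure.pi fun _ : Fin n => P]
      = Var[fun x => 𝔼 σ : Equiv.Perm (Fin n), 𝔼 i, φ (subsample x (σ • B i));
          Measure.pi fun _ => P] := by simp only [funext fun x => uStatistic_eq_expect_perm φ x B]
    _ ≤ 𝔼 σ : Equiv.Perm (Fin n), Var[fun x : Fin n → 𝒳 => 𝔼 i, φ (subsample x (σ • B i));
          Measure.pi fun _ => P] :=
        variance_expect_le fun σ => memLp_expect fun i =>
          hφ.comp_measurePreserving (measurePreserving_subsample P (σ • B i))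
    _ = Var[φ; Measure.pi fun _ => P] / (n / b : ℕ) := by
        simp only [variance_expect_subsample_of_pairwise_disjoint (hdisj _) hφ,
          Fintype.expect_const, Fintype.card_fin]

end UStatistic

section InProbability

variable {Ω ι : Type*} [MeasurableSpace Ω]

/-- The filter of the sets of pairs `(i, ω)` whose section at `i` has a complement of measure
tending to `0` along `l`. For a probability measure, convergence along this filter is convergence in
probability; as a filter it also makes sense for values in a non-metrized topological space. -/
def inProbability (μ : Measure Ω) (l : Filter ι) : Filter (ι × Ω) where
  sets := {A | Tendsto (fun i => μ {ω | (i, ω) ∉ A}) l (𝓝 0)}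
  univ_sets := by simpa using tendsto_const_nhds
  sets_of_superset {A B} hA hAB :=
    tendsto_of_tendsto_of_tendsto_of_le_of_le tendsto_const_nhds hA (fun _ => zero_le)
      fun _ => measure_mono fun _ h h' => h (hAB h')
  inter_sets {A B} hA hB := by
    refine tendsto_of_tendsto_of_tendsto_of_le_of_le tendsto_const_nhds
      (by simpa using Tendsto.add hA hB) (fun _ => zero_le) fun i => ?_
    exact (measure_mono fun ω h => not_and_or.1 h).trans (measure_union_le _ _)

variable {μ : Measure Ω} {l : Filter ι}

theorem eventually_inProbability {p : ι × Ω → Prop} :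
    (∀ᶠ x in inProbability μ l, p x) ↔ Tendsto (fun i => μ {ω | ¬ p (i, ω)}) l (𝓝 0) :=
  Iff.rfl

theorem tendsto_fst_inProbability : Tendsto Prod.fst (inProbability μ l) l := fun s hs =>
  tendsto_nhds_of_eventually_eq (Eventually.mono hs fun i (hi : i ∈ s) => by simp [hi])

theorem tendsto_inProbability_iff_tendstoInMeasure {E : Type*} [PseudoEMetricSpace E]
    {f : ι → Ω → E} {c : E} :
    Tendsto (fun x : ι × Ω => f x.1 x.2) (inProbability μ l) (𝓝 c) ↔
      TendstoInMeasure μ f l fun _ => c := by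
  simp only [Metric.nhds_basis_eball.tendsto_right_iff, eventually_inProbability,
    TendstoInMeasure, Metric.mem_eball, not_lt]

theorem tendsto_inProbability_of_tendsto_variance [IsFiniteMeasure μ] {Z : ι → Ω → ℝ} {c : ℝ}
    (hZ : ∀ᶠ i in l, MemLp (Z i) 2 μ) (hmean : Tendsto (fun i => ∫ ω, Z i ω ∂μ) l (𝓝 c))
    (hvar : Tendsto (fun i => Var[Z i; μ]) l (𝓝 0)) :
    Tendsto (fun x : ι × Ω => Z x.1 x.2) (inProbability μ l) (𝓝 c) := by
  suffices hcentered :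
      Tendsto (fun x : ι × Ω => Z x.1 x.2 - ∫ ω, Z x.1 ω ∂μ) (inProbability μ l) (𝓝 0) by
    simpa using hcentered.add (hmean.comp tendsto_fst_inProbability)
  simp only [Metric.nhds_basis_ball.tendsto_right_iff, eventually_inProbability, mem_ball_zero_iff,
    not_lt, Real.norm_eq_abs]
  intro ε hε
  have hbound : Tendsto (fun i => ENNReal.ofReal (Var[Z i; μ] / ε ^ 2)) l (𝓝 0) := by
    simpa using ENNReal.tendsto_ofReal (hvar.div_const (ε ^ 2))
  refine tendsto_of_tendsto_of_tendsto_of_le_of_le' tendsto_const_nhds hbound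
    (Eventually.of_forall fun _ => zero_le) ?_
  filter_upwards [hZ] with i hi using meas_ge_le_variance_div_sq hi hε

end InProbability

section Quantile

/-- The smallest `p`-quantile of a distribution `ν` on the line, for `0 < p < 1`. -/
noncomputable def quantile (ν : Measure ℝ) (p : ℝ) : ℝ :=
  sInf {x | p ≤ cdf ν x}

variable {p : ℝ}

theorem quantile_le_iff (hp0 : 0 < p) (hp1 : p < 1) (ν : Measure ℝ) (x : ℝ) :
    quantile ν p ≤ x ↔ p ≤ cdf ν x := by
  have hne : {x | p ≤ cdf ν x}.Nonempty :=
    ((tendsto_cdf_atTop ν).eventually (eventually_ge_nhds hp1)).exists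
  have hbdd : BddBelow {x | p ≤ cdf ν x} := by
    obtain ⟨u, hu⟩ := ((tendsto_cdf_atBot ν).eventually (eventually_lt_nhds hp0)).exists
    exact ⟨u, fun x hx => ((monotone_cdf ν).reflect_lt (hu.trans_le hx)).le⟩
  refine ⟨fun h => ?_, fun h => csInf_le hbdd h⟩
  refine ge_of_tendsto (((cdf ν).right_continuous x).tendsto.mono_left
    (nhdsWithin_mono x Set.Ioi_subset_Ici_self)) ?_
  filter_upwards [self_mem_nhdsWithin] with u hu
  obtain ⟨y, hy, hyu⟩ := exists_lt_of_csInf_lt hne (h.trans_lt hu)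
  exact le_trans hy (monotone_cdf ν hyu.le)

theorem lt_quantile_iff (hp0 : 0 < p) (hp1 : p < 1) (ν : Measure ℝ) (x : ℝ) :
    x < quantile ν p ↔ cdf ν x < p :=
  lt_iff_lt_of_le_iff_le (quantile_le_iff hp0 hp1 ν x)

variable {ι : Type*} {l : Filter ι} {νs : ι → ProbabilityMeasure ℝ} {ν : ProbabilityMeasure ℝ}

theorem eventually_lt_quantile_of_tendsto (hp0 : 0 < p) (hp1 : p < 1) (hν : Tendsto νs l (𝓝 ν))
    {u : ℝ} (hu : u < quantile ν p) : ∀ᶠ i in l, u < quantile (νs i) p := by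
  simp only [lt_quantile_iff hp0 hp1, ← ENNReal.ofReal_lt_ofReal_iff hp0, ofReal_cdf] at hu ⊢
  exact eventually_lt_of_limsup_lt <|
    (ProbabilityMeasure.limsup_measure_closed_le_of_tendsto hν isClosed_Iic).trans_lt hu

theorem eventually_quantile_le_of_tendsto (hp0 : 0 < p) (hp1 : p < 1) (hν : Tendsto νs l (𝓝 ν))
    {v : ℝ} (hv : p < cdf ν v) {u : ℝ} (hvu : v < u) : ∀ᶠ i in l, quantile (νs i) p ≤ u := by
  have hlim : ENNReal.ofReal p < l.liminf fun i => (νs i : Measure ℝ) (Set.Iio u) :=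
    calc ENNReal.ofReal p < ENNReal.ofReal (cdf ν v) := by
          rwa [ENNReal.ofReal_lt_ofReal_iff_of_nonneg hp0.le]
      _ ≤ (ν : Measure ℝ) (Set.Iio u) := by
          rw [ofReal_cdf]
          exact measure_mono (Set.Iic_subset_Iio.2 hvu)
      _ ≤ _ := ProbabilityMeasure.le_liminf_measure_open_of_tendsto hν isOpen_Iio
  filter_upwards [eventually_lt_of_lt_liminf hlim] with i hi
  rw [quantile_le_iff hp0 hp1, ← ENNReal.ofReal_le_ofReal_iff (cdf_nonneg _ _), ofReal_cdf]
  exact hi.le.trans (measure_mono Set.Iio_subset_Iic_self)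

theorem tendsto_quantile (hp0 : 0 < p) (hp1 : p < 1) (hν : Tendsto νs l (𝓝 ν))
    (hright : ∀ x > quantile ν p, p < cdf ν x) :
    Tendsto (fun i => quantile (νs i) p) l (𝓝 (quantile ν p)) := by
  refine tendsto_order.2 ⟨fun u hu => eventually_lt_quantile_of_tendsto hp0 hp1 hν hu,
    fun u hu => ?_⟩
  obtain ⟨w, hqw, hwu⟩ := exists_between hu
  obtain ⟨v, hqv, hvw⟩ := exists_between hqw
  exact (eventually_quantile_le_of_tendsto hp0 hp1 hν (hright v hqv) hvw).mono
    fun i hi => hi.trans_lt hwu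

theorem limsup_measure_lt_le {Ω : Type*} [MeasurableSpace Ω] {μ : Measure Ω} {q Z : ι → Ω → ℝ}
    {c : ℝ} (hZ : ∀ i, HasLaw (Z i) (νs i : Measure ℝ) μ) (hν : Tendsto νs l (𝓝 ν))
    (hcont : ContinuousAt (cdf ν) c) (hq : ∀ u < c, ∀ᶠ x in inProbability μ l, u < q x.1 x.2) :
    limsup (fun i => μ {ω | q i ω < Z i ω}) l ≤ ENNReal.ofReal (1 - cdf ν c) := by
  have hbound : ∀ u < c, ∀ v < u,
      limsup (fun i => μ {ω | q i ω < Z i ω}) l ≤ ENNReal.ofReal (1 - cdf ν v) := by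
    intro u huc v hvu
    have hunion (i : ι) : μ {ω | q i ω < Z i ω} ≤
        (νs i : Measure ℝ) (Set.Ici u) + μ {ω | ¬ u < q i ω} := by
      rw [show (νs i : Measure ℝ) (Set.Ici u) = μ {ω | u ≤ Z i ω} from
        ((hZ i).measure_eq measurableSet_Ici).symm]
      refine (measure_mono fun ω hω => ?_).trans (measure_union_le _ _)
      exact (lt_or_ge u (q i ω)).imp (fun h => h.le.trans (le_of_lt hω)) not_lt_of_ge
    calc limsup (fun i => μ {ω | q i ω < Z i ω}) l
        ≤ limsup (fun i => (νs i : Measure ℝ) (Set.Ici u) + μ {ω | ¬ u < q i ω}) l :=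
          limsup_le_limsup (Eventually.of_forall hunion)
      _ = limsup (fun i => (νs i : Measure ℝ) (Set.Ici u)) l :=
          ENNReal.limsup_add_of_right_tendsto_zero (eventually_inProbability.1 (hq u huc)) _
      _ ≤ (ν : Measure ℝ) (Set.Ici u) :=
          ProbabilityMeasure.limsup_measure_closed_le_of_tendsto hν isClosed_Ici
      _ ≤ (ν : Measure ℝ) (Set.Ioi v) := measure_mono (Set.Ici_subset_Ioi.2 hvu)
      _ = ENNReal.ofReal (1 - cdf ν v) := by
          rw [cdf_eq_real, ← probReal_compl_eq_one_sub measurableSet_Iic, Set.compl_Iic,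
            ofReal_measureReal]
  have hlim : Tendsto (fun v => ENNReal.ofReal (1 - cdf ν v)) (𝓝[<] c)
      (𝓝 (ENNReal.ofReal (1 - cdf ν c))) :=
    ENNReal.tendsto_ofReal (tendsto_const_nhds.sub (hcont.tendsto.mono_left nhdsWithin_le_nhds))
  refine ge_of_tendsto hlim ?_
  filter_upwards [self_mem_nhdsWithin] with v (hvc : v < c)
  obtain ⟨u, hvu, huc⟩ := exists_between hvc
  exact hbound u huc v hvu

end Quantile

section KMaxLaw

variable {ι : Type*} [Fintype ι]

/-- The distribution of the `k`-max of a random vector with joint distribution `G`. -/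
noncomputable def kMaxLaw (k : ℕ) (G : ProbabilityMeasure (ι → ℝ)) : ProbabilityMeasure ℝ :=
  G.map (f := fun y => kMax k Finset.univ y)
    (lipschitzWith_kMax k Finset.univ).continuous.measurable.aemeasurable

theorem tendsto_kMaxLaw {κ : Type*} {l : Filter κ} (k : ℕ) {Gs : κ → ProbabilityMeasure (ι → ℝ)}
    {G : ProbabilityMeasure (ι → ℝ)} (hG : Tendsto Gs l (𝓝 G)) :
    Tendsto (fun i => kMaxLaw k (Gs i)) l (𝓝 (kMaxLaw k G)) :=
  ProbabilityMeasure.tendsto_map_of_tendsto_of_continuous _ _ hG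
    (lipschitzWith_kMax k Finset.univ).continuous

variable {s : ℕ} {K : Finset (Fin s)}

theorem cdf_kMaxLaw (k : ℕ) (G : ProbabilityMeasure (K → ℝ)) : cdf (kMaxLaw k G) = kMaxCdf G k :=
  funext fun x => (cdf_eq_real _ x).trans <| map_measureReal_apply
    (lipschitzWith_kMax k Finset.univ).continuous.measurable measurableSet_Iic

theorem quantile_kMaxLaw (k : ℕ) (G : ProbabilityMeasure (K → ℝ)) (p : ℝ) :
    quantile (kMaxLaw k G) p = kMaxQuantile G k p := by
  rw [quantile, cdf_kMaxLaw, kMaxQuantile]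

end KMaxLaw

section SubsampleSize

variable {b : ℕ → ℕ}

theorem tendsto_natDiv_atTop_of_tendsto_div (hb : Tendsto b atTop atTop)
    (hbn : Tendsto (fun n => (b n : ℝ) / (n : ℝ)) atTop (𝓝 0)) :
    Tendsto (fun n => n / b n) atTop atTop := by
  have hpos : ∀ᶠ n : ℕ in atTop, 0 < (b n : ℝ) / n := by
    filter_upwards [hb.eventually_gt_atTop 0, eventually_gt_atTop 0] with n hbn hn
    positivity
  have hinv : Tendsto (fun n : ℕ => (n : ℝ) / b n) atTop atTop :=
    (tendsto_nhdsWithin_iff.2 ⟨hbn, hpos⟩).inv_tendsto_nhdsGT_zero.congr fun n => inv_div _ _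
  simpa only [Function.comp_def, Nat.floor_div_eq_div] using tendsto_nat_floor_atTop.comp hinv

theorem eventually_le_of_tendsto_natDiv (hnb : Tendsto (fun n => n / b n) atTop atTop) :
    ∀ᶠ n in atTop, b n ≤ n :=
  (hnb.eventually_gt_atTop 0).mono fun _ hn => (Nat.div_pos_iff.1 hn).2

end SubsampleSize

section SubLaw

variable {𝒳 : Type*} {s : ℕ} {T : (n : ℕ) → Fin s → (Fin n → 𝒳) → ℝ} {b n k : ℕ} {p : ℝ}

theorem coe_subLaw (h : b ≤ n) (x : Fin n → 𝒳) (K : Finset (Fin s)) :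
    (subLaw T b x K : Measure (K → ℝ)) = subMeasure T b x K := by
  have hsub : subLaw T b x K = ⟨subMeasure T b x K, isProbabilityMeasure_subMeasure T h x K⟩ :=
    dif_pos h
  rw [hsub, ProbabilityMeasure.coe_mk]

theorem integral_subLaw (h : b ≤ n) (x : Fin n → 𝒳) (K : Finset (Fin s)) (f : (K → ℝ) → ℝ) :
    ∫ y, f y ∂(subLaw T b x K : Measure (K → ℝ)) =
      uStatistic (fun z : Fin b → 𝒳 => f fun i => T b i z) x := by
  have hsum : ∫ y, f y ∂(subLaw T b x K : Measure (K → ℝ)) =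
      𝔼 a : {a : Finset (Fin n) // a.card = b}, f fun i => subStat T b x a i := by
    rw [coe_subLaw h, subMeasure, integral_smul_measure,
      integral_finsetSum_measure fun a _ => integrable_dirac (by simp)]
    simp [Fintype.expect_eq_sum_div_card, div_eq_inv_mul]
  exact hsum.trans (Fintype.expect_equiv (Equiv.subtypeEquivRight fun _ =>
    Set.powersetCard.mem_iff.symm) _ _ fun _ => rfl)

theorem kMaxCdf_subLaw (h : b ≤ n) (x : Fin n → 𝒳) (K : Finset (Fin s)) :
    kMaxCdf (subLaw T b x K) k = subCdf T b x K k := by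
  ext u
  rw [kMaxCdf, coe_subLaw h, subMeasure, measureReal_ennreal_smul_apply, measureReal_def,
    Measure.finsetSum_apply, ENNReal.toReal_sum fun a _ => measure_ne_top _ _]
  simp only [subCdf, Measure.dirac_apply, Set.indicator_apply, Set.mem_ofPred_eq, Pi.one_apply,
    kMax_univ_coe K (subStat T b x _), apply_ite ENNReal.toReal, ENNReal.toReal_one,
    ENNReal.toReal_zero, ENNReal.toReal_inv, ENNReal.toReal_natCast]

theorem subQuantile_eq_quantile (h : b ≤ n) (x : Fin n → 𝒳) (K : Finset (Fin s)) :
    subQuantile T b x k p K = quantile (kMaxLaw k (subLaw T b x K)) p := by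
  rw [quantile_kMaxLaw, kMaxQuantile, kMaxCdf_subLaw h, subQuantile]

theorem subCdf_antitone_set (hk : 1 ≤ k) {K K' : Finset (Fin s)} (hK : k ≤ K.card)
    (hKK' : K ⊆ K') (x : Fin n → 𝒳) (u : ℝ) : subCdf T b x K' k u ≤ subCdf T b x K k u := by
  refine mul_le_mul_of_nonneg_left (Finset.sum_le_sum fun a _ => ?_) (by positivity)
  have hmono := kMax_mono_set hk hK hKK' (subStat T b x a)
  split_ifs with h' h
  exacts [le_rfl, absurd (hmono.trans h') h, zero_le_one, le_rfl]

theorem subQuantile_mono_set (hk : 1 ≤ k) (hp0 : 0 < p) (hp1 : p < 1) (h : b ≤ n)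
    {K K' : Finset (Fin s)} (hK : k ≤ K.card) (hKK' : K ⊆ K') (x : Fin n → 𝒳) :
    subQuantile T b x k p K ≤ subQuantile T b x k p K' := by
  rw [subQuantile_eq_quantile h, quantile_le_iff hp0 hp1, cdf_kMaxLaw, kMaxCdf_subLaw h]
  refine le_trans ?_ (subCdf_antitone_set hk hK hKK' x _)
  rw [← kMaxCdf_subLaw h, ← cdf_kMaxLaw, ← quantile_le_iff hp0 hp1, subQuantile_eq_quantile h]

theorem eventually_subQuantile_eq_quantile {Ω : Type*} [MeasurableSpace Ω] {μ : Measure Ω}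
    {b : ℕ → ℕ} (hnb : Tendsto (fun n => n / b n) atTop atTop) (X : ℕ → Ω → 𝒳)
    (T : (n : ℕ) → Fin s → (Fin n → 𝒳) → ℝ) (k : ℕ) (p : ℝ) (K : Finset (Fin s)) :
    ∀ᶠ x : ℕ × Ω in inProbability μ atTop, subQuantile T (b x.1) (sample X x.1 x.2) k p K =
      quantile (kMaxLaw k (subLaw T (b x.1) (sample X x.1 x.2) K)) p :=
  (tendsto_fst_inProbability.eventually (eventually_le_of_tendsto_natDiv hnb)).mono
    fun _ hx => subQuantile_eq_quantile hx _ K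

end SubLaw

section Consistency

variable {Ω 𝒳 : Type*} [MeasurableSpace Ω] [MeasurableSpace 𝒳] {μ : Measure Ω}

theorem hasLaw_sample {P : Measure 𝒳} [IsProbabilityMeasure P] {X : ℕ → Ω → 𝒳}
    (hlaw : ∀ j, HasLaw (X j) P μ) (hindep : iIndepFun X μ) (n : ℕ) :
    HasLaw (sample X n) (Measure.pi fun _ => P) μ :=
  (hindep.precomp (g := fun j : Fin n => (j : ℕ)) Fin.val_injective).hasLaw_pi fun _ => hlaw _

variable {b : ℕ → ℕ}

theorem tendsto_uStatistic_inProbability {P : Measure 𝒳} [IsProbabilityMeasure P]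
    {φ : (m : ℕ) → (Fin m → 𝒳) → ℝ} {C c : ℝ}
    (hφ : ∀ m, MemLp (φ m) 2 (Measure.pi fun _ => P))
    (hvar : ∀ m, Var[φ m; Measure.pi fun _ => P] ≤ C)
    (hmean : Tendsto (fun m => ∫ x, φ m x ∂(Measure.pi fun _ => P)) atTop (𝓝 c))
    (hb : Tendsto b atTop atTop) (hnb : Tendsto (fun n => n / b n) atTop atTop)
    {ξ : (n : ℕ) → Ω → Fin n → 𝒳} (hξ : ∀ n, HasLaw (ξ n) (Measure.pi fun _ => P) μ) :
    Tendsto (fun x : ℕ × Ω => uStatistic (φ (b x.1)) (ξ x.1 x.2)) (inProbability μ atTop)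
      (𝓝 c) := by
  have := (hξ 0).isProbabilityMeasure
  have hU (n : ℕ) : MemLp (uStatistic (φ (b n))) 2 (μ.map (ξ n)) :=
    (hξ n).map_eq.symm ▸ memLp_uStatistic (hφ (b n))
  have hb_pos_le : ∀ᶠ n in atTop, 0 < b n ∧ b n ≤ n :=
    (hnb.eventually_gt_atTop 0).mono fun n => (Nat.div_pos_iff).1
  refine tendsto_inProbability_of_tendsto_variance
    (Z := fun n ω => uStatistic (φ (b n)) (ξ n ω)) (Eventually.of_forall fun n => ?_) ?_ ?_
  · exact MemLp.comp_of_map (g := uStatistic (φ (b n))) (hU n) (hξ n).aemeasurable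
  · refine (hmean.comp hb).congr' ?_
    filter_upwards [hb_pos_le] with n hn
    rw [← integral_map (hξ n).aemeasurable (hU n).aestronglyMeasurable, (hξ n).map_eq]
    exact (integral_uStatistic hn.2 ((hφ (b n)).integrable one_le_two)).symm
  · have hbound : Tendsto (fun n => C / (n / b n : ℕ)) atTop (𝓝 0) :=
      tendsto_const_nhds.div_atTop (tendsto_natCast_atTop_atTop.comp hnb)
    refine tendsto_of_tendsto_of_tendsto_of_le_of_le' tendsto_const_nhds hbound
      (Eventually.of_forall fun n => variance_nonneg _ _) ?_
    filter_upwards [hb_pos_le] with n hn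
    calc Var[fun ω => uStatistic (φ (b n)) (ξ n ω); μ]
        = Var[uStatistic (φ (b n)); Measure.pi fun _ => P] := by
          rw [← (hξ n).map_eq, variance_map (hU n).aemeasurable (hξ n).aemeasurable,
            Function.comp_def]
      _ ≤ Var[φ (b n); Measure.pi fun _ => P] / (n / b n : ℕ) :=
          variance_uStatistic_le hn.1 hn.2 (hφ (b n))
      _ ≤ C / (n / b n : ℕ) := by gcongr; exact hvar _

variable {P : ProbabilityMeasure 𝒳} {X : ℕ → Ω → 𝒳} {s : ℕ}
  {T : (n : ℕ) → Fin s → (Fin n → 𝒳) → ℝ} {hT : ∀ n i, Measurable (T n i)}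
  {K : Finset (Fin s)} {G : ProbabilityMeasure (K → ℝ)}

theorem tendsto_subLaw (hlaw : ∀ j, HasLaw (X j) (P : Measure 𝒳) μ) (hindep : iIndepFun X μ)
    (hG : Tendsto (fun n => jointLaw T hT P n K) atTop (𝓝 G)) (hb : Tendsto b atTop atTop)
    (hnb : Tendsto (fun n => n / b n) atTop atTop) :
    Tendsto (fun x : ℕ × Ω => subLaw T (b x.1) (sample X x.1 x.2) K) (inProbability μ atTop)
      (𝓝 G) := by
  rw [ProbabilityMeasure.tendsto_iff_forall_integral_tendsto] at hG ⊢
  intro f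
  let φ : (m : ℕ) → (Fin m → 𝒳) → ℝ := fun m x => f fun i : K => T m i x
  have hTm (m : ℕ) : Measurable fun (x : Fin m → 𝒳) (i : K) => T m i x :=
    measurable_pi_lambda _ fun i => hT m i
  have hφ (m : ℕ) : Measurable (φ m) := f.continuous.measurable.comp (hTm m)
  have hmean (m : ℕ) : ∫ y, f y ∂(jointLaw T hT P m K : Measure (K → ℝ)) =
      ∫ x, φ m x ∂(Measure.pi fun _ => (P : Measure 𝒳)) :=
    integral_map (hTm m).aemeasurable f.continuous.measurable.aestronglyMeasurable
  refine (tendsto_uStatistic_inProbability (φ := φ) (C := ((‖f‖ - -‖f‖) / 2) ^ 2) (fun m => ?_)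
    (fun m => ?_) (by simpa only [hmean] using hG f) hb hnb (hasLaw_sample hlaw hindep)).congr' ?_
  · exact MemLp.of_bound (hφ m).aestronglyMeasurable ‖f‖ (ae_of_all _ fun x => f.norm_coe_le_norm _)
  · exact variance_le_sq_of_bounded
      (ae_of_all _ fun x => abs_le.1 (f.norm_coe_le_norm _)) (hφ m).aemeasurable
  · filter_upwards [tendsto_fst_inProbability.eventually (eventually_le_of_tendsto_natDiv hnb)]
      with x hx
    exact (integral_subLaw hx _ K f).symm

theorem eventually_lt_subQuantile {k : ℕ} {p : ℝ} (hp0 : 0 < p) (hp1 : p < 1)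
    (hlaw : ∀ j, HasLaw (X j) (P : Measure 𝒳) μ) (hindep : iIndepFun X μ)
    (hG : Tendsto (fun n => jointLaw T hT P n K) atTop (𝓝 G)) (hb : Tendsto b atTop atTop)
    (hnb : Tendsto (fun n => n / b n) atTop atTop) {u : ℝ} (hu : u < kMaxQuantile G k p) :
    ∀ᶠ x in inProbability μ atTop, u < subQuantile T (b x.1) (sample X x.1 x.2) k p K := by
  rw [← quantile_kMaxLaw] at hu
  have hweak := tendsto_kMaxLaw k (tendsto_subLaw hlaw hindep hG hb hnb)
  filter_upwards [eventually_subQuantile_eq_quantile hnb X T k p K,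
    eventually_lt_quantile_of_tendsto hp0 hp1 hweak hu] with x heq hx
  exact hx.trans_eq heq.symm

theorem tendsto_subQuantile {k : ℕ} {p : ℝ} (hp0 : 0 < p) (hp1 : p < 1)
    (hlaw : ∀ j, HasLaw (X j) (P : Measure 𝒳) μ) (hindep : iIndepFun X μ)
    (hG : Tendsto (fun n => jointLaw T hT P n K) atTop (𝓝 G)) (hb : Tendsto b atTop atTop)
    (hnb : Tendsto (fun n => n / b n) atTop atTop)
    (hright : ∀ x > kMaxQuantile G k p, kMaxCdf G k (kMaxQuantile G k p) < kMaxCdf G k x) :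
    Tendsto (fun x : ℕ × Ω => subQuantile T (b x.1) (sample X x.1 x.2) k p K)
      (inProbability μ atTop) (𝓝 (kMaxQuantile G k p)) := by
  simp only [← quantile_kMaxLaw, ← cdf_kMaxLaw] at hright ⊢
  have hweak := tendsto_kMaxLaw k (tendsto_subLaw hlaw hindep hG hb hnb)
  refine (tendsto_quantile hp0 hp1 hweak fun x hx => ?_).congr'
    ((eventually_subQuantile_eq_quantile hnb X T k p K).mono fun _ => Eq.symm)
  exact ((quantile_le_iff hp0 hp1 _ _).1 le_rfl).trans_lt (hright x hx)

theorem hasLaw_kMax (hlaw : ∀ j, HasLaw (X j) (P : Measure 𝒳) μ) (hindep : iIndepFun X μ)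
    (hT : ∀ n i, Measurable (T n i)) (k n : ℕ) (K : Finset (Fin s)) :
    HasLaw (fun ω => kMax k K fun i => T n i (sample X n ω))
      (kMaxLaw k (jointLaw T hT P n K) : Measure ℝ) μ := by
  have hjoint : HasLaw (fun x (i : K) => T n i x) (jointLaw T hT P n K : Measure (K → ℝ))
      (Measure.pi fun _ : Fin n => (P : Measure 𝒳)) :=
    ⟨(measurable_pi_lambda _ fun i : K => hT n i).aemeasurable, rfl⟩
  have hkMax : HasLaw (fun y => kMax k Finset.univ y)
      (kMaxLaw k (jointLaw T hT P n K) : Measure ℝ) (jointLaw T hT P n K : Measure (K → ℝ)) :=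
    ⟨(lipschitzWith_kMax k Finset.univ).continuous.measurable.aemeasurable, rfl⟩
  simp only [← fun ω => kMax_univ_coe (k := k) K fun i => T n i (sample X n ω)]
  exact hkMax.fun_comp (hjoint.fun_comp (hasLaw_sample hlaw hindep n))

theorem limsup_measure_le_card_stepDown_inter_le {k : ℕ} {p : ℝ} (hk : 1 ≤ k) (hp0 : 0 < p)
    (hp1 : p < 1) (hlaw : ∀ j, HasLaw (X j) (P : Measure 𝒳) μ) (hindep : iIndepFun X μ)
    (hG : Tendsto (fun n => jointLaw T hT P n K) atTop (𝓝 G)) (hb : Tendsto b atTop atTop)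
    (hnb : Tendsto (fun n => n / b n) atTop atTop)
    (hcont : k ≤ K.card → ContinuousAt (kMaxCdf G k) (kMaxQuantile G k p)) :
    limsup (fun n => μ {ω | k ≤ (stepDown k (subQuantile T (b n) (sample X n ω) k p)
      (fun i => T n i (sample X n ω)) ∩ K).card}) atTop ≤ ENNReal.ofReal (1 - p) := by
  rcases lt_or_ge K.card k with hkK | hkK
  · have hempty (A : Finset (Fin s)) : ¬ k ≤ (A ∩ K).card := fun h =>
      (h.trans (Finset.card_le_card Finset.inter_subset_right)).not_gt hkK
    simp [hempty]
  calc limsup (fun n => μ {ω | k ≤ (stepDown k (subQuantile T (b n) (sample X n ω) k p)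
        (fun i => T n i (sample X n ω)) ∩ K).card}) atTop
      ≤ limsup (fun n => μ {ω | subQuantile T (b n) (sample X n ω) k p K <
          kMax k K fun i => T n i (sample X n ω)}) atTop := by
        refine limsup_le_limsup ?_
        filter_upwards [eventually_le_of_tendsto_natDiv hnb] with n hn
        exact measure_mono fun ω => lt_kMax_of_le_card_stepDown_inter hk
          fun K' hK' => subQuantile_mono_set hk hp0 hp1 hn hkK hK' _
    _ ≤ ENNReal.ofReal (1 - cdf (kMaxLaw k G) (kMaxQuantile G k p)) :=
        limsup_measure_lt_le (hasLaw_kMax hlaw hindep hT k · K) (tendsto_kMaxLaw k hG)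
          (cdf_kMaxLaw k G ▸ hcont hkK)
          fun u hu => eventually_lt_subQuantile hp0 hp1 hlaw hindep hG hb hnb hu
    _ ≤ ENNReal.ofReal (1 - p) := by
        rw [← quantile_kMaxLaw]
        gcongr
        exact (quantile_le_iff hp0 hp1 _ _).1 le_rfl

theorem tendstoInMeasure_dist_subLaw_jointLaw {ρ : MetricSpace (ProbabilityMeasure (K → ℝ))}
    (hρ : MetrizesWeakConvergence ρ) (hlaw : ∀ j, HasLaw (X j) (P : Measure 𝒳) μ)
    (hindep : iIndepFun X μ) (hG : Tendsto (fun n => jointLaw T hT P n K) atTop (𝓝 G))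
    (hb : Tendsto b atTop atTop) (hnb : Tendsto (fun n => n / b n) atTop atTop) :
    TendstoInMeasure μ
      (fun n ω => ρ.dist (subLaw T (b n) (sample X n ω) K) (jointLaw T hT P n K))
      atTop fun _ => (0 : ℝ) := by
  have hsub := tendsto_subLaw hlaw hindep hG hb hnb
  have hjoint := hG.comp (tendsto_fst_inProbability (μ := μ))
  have hρ' : ρ.toPseudoMetricSpace.toUniformSpace.toTopologicalSpace =
      ProbabilityMeasure.instTopologicalSpace := hρ
  rw [← hρ'] at hsub hjoint
  have hdist := @Filter.Tendsto.dist _ _ ρ.toPseudoMetricSpace _ _ _ _ _ hsub hjoint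
  rw [@dist_self _ ρ.toPseudoMetricSpace] at hdist
  exact tendsto_inProbability_iff_tendstoInMeasure.1 hdist

end Consistency

end SubsamplingKFWER

open SubsamplingKFWER in
theorem theorem3p4_general {Ω 𝒳 : Type*} [MeasurableSpace Ω] [MeasurableSpace 𝒳]
    {μ : Measure Ω} {P : ProbabilityMeasure 𝒳}
    {X : ℕ → Ω → 𝒳} (hlaw : ∀ j, HasLaw (X j) (P : Measure 𝒳) μ) (hindep : iIndepFun X μ)
    {s : ℕ} {T : (n : ℕ) → Fin s → (Fin n → 𝒳) → ℝ} (hT : ∀ n i, Measurable (T n i))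
    {k : ℕ} (hk : 1 ≤ k) {α : ℝ} (hα0 : 0 < α) (hα1 : α < 1)
    {K : Finset (Fin s)} {G : ProbabilityMeasure (K → ℝ)}
    (hG : Tendsto (fun n => jointLaw T hT P n K) atTop (𝓝 G))
    {b : ℕ → ℕ} (hb : Tendsto b atTop atTop)
    (hbn : Tendsto (fun n => (b n : ℝ) / (n : ℝ)) atTop (𝓝 0)) :
    (∀ ρ : MetricSpace (ProbabilityMeasure (K → ℝ)), MetrizesWeakConvergence ρ →
      TendstoInMeasure μ
        (fun n ω => ρ.dist (subLaw T (b n) (sample X n ω) K) (jointLaw T hT P n K))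
        atTop (fun _ => (0 : ℝ))) ∧
    (k ≤ K.card →
      (∀ x > kMaxQuantile G k (1 - α), kMaxCdf G k (kMaxQuantile G k (1 - α)) < kMaxCdf G k x) →
      TendstoInMeasure μ (fun n ω => subQuantile T (b n) (sample X n ω) k (1 - α) K)
        atTop (fun _ => kMaxQuantile G k (1 - α))) ∧
    ((k ≤ K.card → ContinuousAt (kMaxCdf G k) (kMaxQuantile G k (1 - α))) →
      limsup (fun n => μ {ω | k ≤ (stepDown k
        (subQuantile T (b n) (sample X n ω) k (1 - α))
        (fun i => T n i (sample X n ω)) ∩ K).card}) atTop ≤ ENNReal.ofReal α) := by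
  have hp0 : 0 < 1 - α := sub_pos.2 hα1
  have hp1 : 1 - α < 1 := sub_lt_self 1 hα0
  have hnb := tendsto_natDiv_atTop_of_tendsto_div hb hbn
  refine ⟨fun ρ hρ => tendstoInMeasure_dist_subLaw_jointLaw hρ hlaw hindep hG hb hnb,
    fun _ hright => tendsto_inProbability_iff_tendstoInMeasure.1 <|
      tendsto_subQuantile hp0 hp1 hlaw hindep hG hb hnb hright, fun hcont => ?_⟩
  simpa only [sub_sub_cancel] using
    limsup_measure_le_card_stepDown_inter_le hk hp0 hp1 hlaw hindep hG hb hnb hcont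

open SubsamplingKFWER in
theorem theorem3p4 {Ω 𝒳 : Type*} [MeasurableSpace Ω] [MeasurableSpace 𝒳]
    (μ : Measure Ω) [IsProbabilityMeasure μ] (P : ProbabilityMeasure 𝒳)
    (X : ℕ → Ω → 𝒳) (hlaw : ∀ j, HasLaw (X j) (P : Measure 𝒳) μ) (hindep : iIndepFun X μ)
    {s : ℕ} (H : Fin s → Set (ProbabilityMeasure 𝒳))
    (T : (n : ℕ) → Fin s → (Fin n → 𝒳) → ℝ) (hT : ∀ n i, Measurable (T n i))
    (k : ℕ) (hk : 1 ≤ k) (α : ℝ) (hα0 : 0 < α) (hα1 : α < 1)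
    (G : ProbabilityMeasure (trueNulls H P → ℝ))
    (hS : AssumptionS T hT P (trueNulls H P) k α G)
    (b : ℕ → ℕ) (hb : Tendsto b atTop atTop)
    (hbn : Tendsto (fun n => (b n : ℝ) / (n : ℝ)) atTop (𝓝 0)) :
    (∀ ρ : MetricSpace (ProbabilityMeasure (trueNulls H P → ℝ)),
      MetrizesWeakConvergence ρ →
      TendstoInMeasure μ
        (fun n ω => ρ.dist (subLaw T (b n) (sample X n ω) (trueNulls H P))
          (jointLaw T hT P n (trueNulls H P)))
        atTop (fun _ => (0 : ℝ))) ∧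
    (k ≤ (trueNulls H P).card →
      TendstoInMeasure μ
        (fun n ω => subQuantile T (b n) (sample X n ω) k (1 - α) (trueNulls H P))
        atTop (fun _ => kMaxQuantile G k (1 - α))) ∧
    limsup (fun n => μ {ω | k ≤ (stepDown k
        (subQuantile T (b n) (sample X n ω) k (1 - α))
        (fun i => T n i (sample X n ω)) ∩ trueNulls H P).card}) atTop ≤ ENNReal.ofReal α := by
  obtain ⟨hdist, hquantile, hfwer⟩ :=
    theorem3p4_general hlaw hindep hT hk hα0 hα1 hS.tendsto_jointLaw hb hbn
  exact ⟨hdist, fun hkI => hquantile hkI (hS.cdf_lt_right hkI), hfwer hS.continuousAt_cdf⟩
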